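/- Let $X$ be an infinite set. For a natural number $n$, an equivalence relation on $X$ is called an $n$-relation if each of its equivalence classes has exactly $n$ elements. Let $\mathrm{Eq}^*(X)$ be the set of all equivalence relations on $X$ that are $n$-relations for some natural number $n$, partially ordered by inclusion. Suppose $\beta$ is an automorphism of the poset $\mathrm{Eq}^*(X)$ (an order preserving bijection of $\mathrm{Eq}^*(X)$ onto itself whose inverse is order preserving) that is size preserving: for every natural number $n$ and every $\theta\in\mathrm{Eq}^*(X)$, if $\theta$ is an $n$-relation, then $\beta(\theta)$ is an $n$-relation. Then there is a permutation $\sigma$ of $X$ such that for every $2$-relation $\pi$ on $X$, \[\beta(\pi)=\sigma(\pi):=\{(\sigma(x),\sigma(y)) : (x,y)\in\pi\}.\] -/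

import Mathlib

/-- An equivalence relation `θ` on `X` is an `n`-relation if each of its equivalence classes has
exactly `n` elements (in particular, every class is finite). -/
def IsNRelation {X : Type*} (n : ℕ) (θ : Setoid X) : Prop :=
  ∀ B ∈ θ.classes, B.encard = (n : ℕ∞)

/-- The poset `Eq*(X)` of finite regular equivalence relations on `X`, i.e. those which are
`n`-relations for some natural number `n`. The order is the one inherited from `Setoid X`, which
is inclusion of relations. -/
abbrev EqStar (X : Type*) : Type _ :=
  {θ : Setoid X // ∃ n : ℕ, IsNRelation n θ}

/-- An automorphism `β` of the poset `Eq*(X)` is size preserving if it takes `n`-relations to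
`n`-relations, for every natural number `n`. -/
def IsSizePreserving {X : Type*} (β : EqStar X ≃o EqStar X) : Prop :=
  ∀ (n : ℕ) (θ : EqStar X), IsNRelation n θ.1 → IsNRelation n (β θ).1

/-- The image `σ(θ) = {(σ x, σ y) : (x, y) ∈ θ}` of an equivalence relation under a
permutation. -/
def permImage {X : Type*} (σ : Equiv.Perm X) (θ : Setoid X) : Setoid X :=
  θ.mapOfSurjective σ
    (fun x y h => by
      have hxy : x = y := σ.injective h
      subst hxy
      exact θ.refl' x)
    σ.surjective

open Equiv Equiv.Perm

/-! View a 2-relation as a perfect matching and a pair of distinct points as an edge. Two distinct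
edges are disjoint exactly when some perfect matching contains both. Hence a translation of edges,
available in both directions and compatible with two families containing all matchings, preserves
incidence, and it then comes from a bijection of points (`exists_vertex_map`,
`exists_equiv_of_edge_maps`). This principle is applied twice.

The first application is to the blocks of a fixed 2-relation `π`. The 4-relations above `π` are the
matchings of the quotient by `π`, and `IsSizePreserving.exists_edge` translates pairs of blocks, so
`β` induces a bijection from the blocks of `π` to those of `β π`.

The second is to `X` itself. It requires that the image of a block `{a, b}` be the same for every
2-relation containing it (`IsSizePreserving.imageBlock_subset`). If two commuting pairings share
infinitely many blocks, there are 4-relations above both that differ exactly on four prescribed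
common blocks. The set where they differ is transported by both block bijections, and two such
quadruples meeting in one block isolate the image of that block. `IsPairing.exists_halfway` removes
the infinitude assumption and `IsPairing.exists_commute` the commutation assumption. -/

/-! ### 2-relations as fixed-point-free involutions. -/

theorem isNRelation_iff {V : Type*} {n : ℕ} {θ : Setoid V} :
    IsNRelation n θ ↔ ∀ x, {y | θ y x}.encard = n := by
  constructor
  · intro h x
    exact h _ ⟨x, rfl⟩
  · rintro h B ⟨x, rfl⟩
    exact h x

theorem IsNRelation.unique {V : Type*} [Nonempty V] {m n : ℕ} {θ : Setoid V}
    (hm : IsNRelation m θ) (hn : IsNRelation n θ) : m = n := by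
  have x : V := Classical.arbitrary V
  have h := (isNRelation_iff.1 hm x).symm.trans (isNRelation_iff.1 hn x)
  exact_mod_cast h

/-- A permutation is a pairing if it is an involution without fixed points. -/
structure IsPairing {V : Type*} (p : Perm V) : Prop where
  sq : ∀ x, p (p x) = x
  ne : ∀ x, p x ≠ x

theorem sameCycle_iff_of_involutive {V : Type*} {p : Perm V} (hp : ∀ x, p (p x) = x) {x y : V} :
    p.SameCycle x y ↔ y = x ∨ y = p x := by
  constructor
  · rintro ⟨k, rfl⟩
    have h2 : p ^ 2 = 1 := by ext z; simp [pow_two, hp]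
    rcases Int.even_or_odd' k with ⟨j, rfl | rfl⟩
    · left
      rw [zpow_mul]
      norm_cast
      simp [h2]
    · right
      rw [zpow_add, zpow_mul]
      norm_cast
      simp [h2]
  · rintro (rfl | rfl)
    · exact SameCycle.refl _ _
    · exact ⟨1, by simp⟩

theorem IsPairing.rel_iff {V : Type*} {p : Perm V} (hp : IsPairing p) {x y : V} :
    SameCycle.setoid p x y ↔ y = x ∨ y = p x :=
  sameCycle_iff_of_involutive hp.sq

theorem IsPairing.isNRelation {V : Type*} {p : Perm V} (hp : IsPairing p) :
    IsNRelation 2 (SameCycle.setoid p) := by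
  rw [isNRelation_iff]
  intro x
  have h : {y | SameCycle.setoid p y x} = {x, p x} := by
    ext y
    rw [Set.mem_ofPred_eq, Setoid.comm', hp.rel_iff]
    rfl
  rw [h, Set.encard_pair (hp.ne x).symm]
  rfl

theorem IsNRelation.exists_isPairing {V : Type*} {θ : Setoid V} (h : IsNRelation 2 θ) :
    ∃ p : Perm V, IsPairing p ∧ SameCycle.setoid p = θ := by
  have key : ∀ x, ∃ y, y ≠ x ∧ ∀ z, θ x z ↔ z = x ∨ z = y := by
    intro x
    obtain ⟨a, b, hab, hs⟩ := Set.encard_eq_two.1 (isNRelation_iff.1 h x)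
    have hs' : ∀ z, θ x z ↔ z = a ∨ z = b := by
      intro z
      rw [Setoid.comm']
      exact Set.ext_iff.1 hs z
    rcases (hs' x).1 (θ.refl' x) with rfl | rfl
    · exact ⟨b, hab.symm, hs'⟩
    · exact ⟨a, hab, fun z => (hs' z).trans or_comm⟩
  choose f hne hf using key
  have hinv : Function.Involutive f := by
    intro x
    have h1 : θ (f x) x := θ.symm' ((hf x _).2 (Or.inr rfl))
    rcases (hf _ _).1 h1 with h2 | h2
    · exact absurd h2.symm (hne x)
    · exact h2.symm
  have hp : IsPairing (hinv.toPerm f) := ⟨hinv, hne⟩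
  refine ⟨hinv.toPerm f, hp, ?_⟩
  ext x y
  rw [hp.rel_iff, hf]
  rfl

theorem IsPairing.conj {V : Type*} {p : Perm V} (hp : IsPairing p) (s : Perm V) :
    IsPairing (s * p * s⁻¹) :=
  ⟨fun x => by simp [hp.sq], fun x h => hp.ne (s⁻¹ x) (by
    rw [Perm.eq_inv_iff_eq]; simpa using h)⟩

/-- An infinite set is equipotent with two disjoint copies of itself, and exchanging the copies has
no fixed point. -/
theorem exists_isPairing (V : Type*) [Infinite V] : ∃ p : Perm V, IsPairing p := by
  have h : Cardinal.mk V = Cardinal.mk (V ⊕ V) := by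
    simp [Cardinal.add_eq_self (Cardinal.aleph0_le_mk V)]
  obtain ⟨e⟩ := Cardinal.eq.1 h
  refine ⟨(e.trans (Equiv.sumComm V V)).trans e.symm, fun x => by simp, fun x hx => ?_⟩
  have h1 : (e x).swap = e x := by
    simpa [Equiv.symm_apply_eq] using hx
  rcases h2 : e x with v | v <;> simp [h2] at h1

/-- An involution with infinitely many fixed points can be changed at its fixed points
to a pairing. -/
theorem exists_isPairing_extending {V : Type*} (P : Perm V) (hP : ∀ v, P (P v) = v)
    (hfix : {v | P v = v}.Infinite) :
    ∃ m : Perm V, IsPairing m ∧ ∀ v, P v ≠ v → m v = P v := by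
  classical
  have : Infinite {v // P v = v} := hfix.to_subtype
  obtain ⟨q, hq⟩ := exists_isPairing {v // P v = v}
  have hfixq : ∀ v, (hv : P v ≠ v) → ofSubtype q v = v := fun v hv =>
    ofSubtype_apply_of_not_mem q hv
  have hq1 : ∀ v, (hv : P v = v) → ofSubtype q v = q ⟨v, hv⟩ := fun v hv =>
    ofSubtype_apply_of_mem q hv
  have hmov : ∀ v, P v ≠ v → P (P v) ≠ P v := fun v hv h => hv (P.injective h)
  have hm1 : ∀ v, (hv : P v = v) → (P * ofSubtype q) v = q ⟨v, hv⟩ := fun v hv => by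
    rw [Perm.mul_apply, hq1 v hv, (q ⟨v, hv⟩).2]
  have hm2 : ∀ v, P v ≠ v → (P * ofSubtype q) v = P v := fun v hv => by
    rw [Perm.mul_apply, hfixq v hv]
  refine ⟨P * ofSubtype q, ⟨fun v => ?_, fun v => ?_⟩, hm2⟩
  · by_cases hv : P v = v
    · rw [hm1 v hv, hm1 _ (q ⟨v, hv⟩).2, Subtype.coe_eta, hq.sq]
    · rw [hm2 v hv, hm2 _ (hmov v hv), hP]
  · by_cases hv : P v = v
    · rw [hm1 v hv]
      exact fun h => hq.ne ⟨v, hv⟩ (Subtype.ext h)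
    · rwa [hm2 v hv]

/-- In addition, two prescribed disjoint pairs of fixed points can be matched. -/
theorem exists_isPairing_extending_pairs {V : Type*} (P : Perm V) (hP : ∀ v, P (P v) = v)
    (hfix : {v | P v = v}.Infinite) {a b c d : V} (ha : P a = a) (hb : P b = b) (hc : P c = c)
    (hd : P d = d) (hab : a ≠ b) (hac : a ≠ c) (had : a ≠ d) (hbc : b ≠ c) (hbd : b ≠ d)
    (hcd : c ≠ d) :
    ∃ m : Perm V, IsPairing m ∧ (∀ v, P v ≠ v → m v = P v) ∧ m a = b ∧ m c = d := by
  classical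
  have hsw : ∀ v, v ≠ a → v ≠ b → v ≠ c → v ≠ d → (P * swap a b * swap c d) v = P v := by
    intro v h1 h2 h3 h4
    simp [swap_apply_of_ne_of_ne, *]
  have hQa : (P * swap a b * swap c d) a = b := by
    simp [swap_apply_of_ne_of_ne, *]
  have hQb : (P * swap a b * swap c d) b = a := by
    simp [swap_apply_of_ne_of_ne, *]
  have hQc : (P * swap a b * swap c d) c = d := by
    simp [swap_apply_of_ne_of_ne, hbd.symm, had.symm, *]
  have hQd : (P * swap a b * swap c d) d = c := by
    simp [swap_apply_of_ne_of_ne, hbc.symm, hac.symm, *]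
  have hP' : ∀ v w, P w = w → v ≠ w → P v ≠ w := fun v w hw hv h =>
    hv (P.injective (h.trans hw.symm))
  obtain ⟨m, hm, hmP⟩ := exists_isPairing_extending (P * swap a b * swap c d) (by
      intro v
      by_cases h1 : v = a
      · rw [h1, hQa, hQb]
      by_cases h2 : v = b
      · rw [h2, hQb, hQa]
      by_cases h3 : v = c
      · rw [h3, hQc, hQd]
      by_cases h4 : v = d
      · rw [h4, hQd, hQc]
      rw [hsw v h1 h2 h3 h4, hsw _ (hP' v a ha h1) (hP' v b hb h2) (hP' v c hc h3)
        (hP' v d hd h4), hP])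
    (by
      refine (hfix.sdiff (Set.toFinite {a, b, c, d})).mono ?_
      rintro v ⟨hv, hv'⟩
      simp only [Set.mem_insert_iff, Set.mem_singleton_iff, not_or] at hv'
      rw [Set.mem_ofPred_eq, hsw v hv'.1 hv'.2.1 hv'.2.2.1 hv'.2.2.2]
      exact hv)
  refine ⟨m, hm, fun v hv => ?_, ?_, ?_⟩
  · have h1 : ∀ w, P w = w → v ≠ w := fun w hw h => hv (h ▸ hw)
    have h2 := hsw v (h1 a ha) (h1 b hb) (h1 c hc) (h1 d hd)
    rw [← h2]
    exact hmP v (by rwa [h2])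
  · rw [hmP a (by rw [hQa]; exact hab.symm), hQa]
  · rw [hmP c (by rw [hQc]; exact hcd.symm), hQc]

/-! ### Edges, perfect matchings and the reconstruction of points. -/

/-- An injective map of the edges of an infinite complete graph to edges of another complete graph
which preserves and reflects incidence is induced by a map of the vertices. -/
theorem exists_vertex_map {V W : Type*} [Infinite V] (F : Sym2 V → Sym2 W)
    (hdiag : ∀ e, ¬e.IsDiag → ¬(F e).IsDiag)
    (hinj : ∀ e f, ¬e.IsDiag → ¬f.IsDiag → F e = F f → e = f)
    (hmeet : ∀ e f, ¬e.IsDiag → ¬f.IsDiag → ((∃ v, v ∈ e ∧ v ∈ f) ↔ ∃ w, w ∈ F e ∧ w ∈ F f)) :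
    ∃ τ : V → W, Function.Injective τ ∧ ∀ a b, a ≠ b → F s(a, b) = s(τ a, τ b) := by
  have star : ∀ v, ∃ w, ∀ c, c ≠ v → w ∈ F s(v, c) := by
    intro v
    obtain ⟨a, ha⟩ := Infinite.exists_notMem_finset ({v} : Finset V)
    obtain ⟨b, hb⟩ := (Set.toFinite {v, a}).exists_notMem
    have hva : v ≠ a := by rintro rfl; simp at ha
    have hvb : v ≠ b := by rintro rfl; simp at hb
    have hab : a ≠ b := by rintro rfl; simp at hb
    have nd : ∀ c, v ≠ c → ¬(s(v, c)).IsDiag := fun c h => by simpa using h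
    have meet : ∀ c d, v ≠ c → v ≠ d → ∃ w, w ∈ F s(v, c) ∧ w ∈ F s(v, d) := fun c d hc hd =>
      (hmeet _ _ (nd c hc) (nd d hd)).1 ⟨v, by simp, by simp⟩
    have ne : ∀ c d, v ≠ c → v ≠ d → c ≠ d → F s(v, c) ≠ F s(v, d) := fun c d hc hd hcd h =>
      hcd (Sym2.congr_right.1 (hinj _ _ (nd c hc) (nd d hd) h))
    obtain ⟨w, hwa, hwb⟩ := meet a b hva hvb
    obtain ⟨x, hx⟩ := Sym2.mem_iff_exists.1 hwa
    obtain ⟨y, hy⟩ := Sym2.mem_iff_exists.1 hwb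
    have hwx : w ≠ x := by simpa [hx] using hdiag _ (nd a hva)
    have hwy : w ≠ y := by simpa [hy] using hdiag _ (nd b hvb)
    have hxy : x ≠ y := by
      rintro rfl
      exact ne a b hva hvb hab (hx.trans hy.symm)
    -- an edge meeting both edges and missing their common vertex is the third side
    have third : ∀ c, v ≠ c → w ∉ F s(v, c) → F s(v, c) = s(x, y) := by
      intro c hc hw
      obtain ⟨u, hu1, hu2⟩ := meet a c hva hc
      obtain ⟨t, ht1, ht2⟩ := meet b c hvb hc
      rw [hx, Sym2.mem_iff] at hu1
      rw [hy, Sym2.mem_iff] at ht1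
      rcases hu1 with rfl | rfl
      · exact absurd hu2 hw
      rcases ht1 with rfl | rfl
      · exact absurd ht2 hw
      exact (Sym2.mem_and_mem_iff hxy).1 ⟨hu2, ht2⟩
    refine ⟨w, fun c hc => ?_⟩
    by_contra hcon
    have hc3 := third c hc.symm hcon
    -- A triangle leaves no room for a fourth edge: the image of `s(v, d)` would have to be one of
    -- its three sides, against injectivity.
    obtain ⟨d, hd⟩ := (Set.toFinite {v, a, b, c}).exists_notMem
    simp only [Set.mem_insert_iff, Set.mem_singleton_iff, not_or] at hd
    obtain ⟨hdv, hda, hdb, hdc⟩ := hd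
    by_cases hwd : w ∈ F s(v, d)
    · obtain ⟨u, hu1, hu2⟩ := meet c d hc.symm (Ne.symm hdv)
      rw [hc3, Sym2.mem_iff] at hu1
      rcases hu1 with rfl | rfl
      · exact ne a d hva (Ne.symm hdv) (Ne.symm hda)
          (hx.trans ((Sym2.mem_and_mem_iff hwx).1 ⟨hwd, hu2⟩).symm)
      · exact ne b d hvb (Ne.symm hdv) (Ne.symm hdb)
          (hy.trans ((Sym2.mem_and_mem_iff hwy).1 ⟨hwd, hu2⟩).symm)
    · exact ne c d hc.symm (Ne.symm hdv) (Ne.symm hdc)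
        (hc3.trans (third d (Ne.symm hdv) hwd).symm)
  choose τ hτ using star
  have hτinj : Function.Injective τ := by
    intro u v huv
    by_contra hne
    obtain ⟨a, ha⟩ := (Set.toFinite {u, v}).exists_notMem
    obtain ⟨b, hb⟩ := (Set.toFinite {u, v, a}).exists_notMem
    simp only [Set.mem_insert_iff, Set.mem_singleton_iff, not_or] at ha hb
    obtain ⟨w, hw1, hw2⟩ := (hmeet s(u, a) s(v, b) (by simpa using Ne.symm ha.1)
      (by simpa using Ne.symm hb.2.1)).2 ⟨τ u, hτ u a ha.1, huv ▸ hτ v b hb.2.1⟩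
    simp only [Sym2.mem_iff] at hw1 hw2
    rcases hw1 with rfl | rfl <;> rcases hw2 with h | h
    · exact hne h
    · exact hb.1 h.symm
    · exact ha.2 h
    · exact hb.2.2 h.symm
  refine ⟨τ, hτinj, fun a b hab => ?_⟩
  refine (Sym2.mem_and_mem_iff (hτinj.ne hab)).1 ⟨hτ a b hab.symm, ?_⟩
  rw [Sym2.eq_swap]
  exact hτ b a hab

/-- The edge `e` lies in a class of `m`. -/
def Setoid.ContainsEdge {V : Type*} (m : Setoid V) (e : Sym2 V) : Prop :=
  ∀ x ∈ e, ∀ y ∈ e, m x y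

theorem Setoid.containsEdge_mk {V : Type*} {m : Setoid V} {a b : V} :
    m.ContainsEdge s(a, b) ↔ m a b := by
  simp only [Setoid.ContainsEdge, Sym2.mem_iff, forall_eq_or_imp, forall_eq]
  exact ⟨fun h => h.1.2, fun h => ⟨⟨m.refl' a, h⟩, m.symm' h, m.refl' b⟩⟩

theorem IsPairing.apply_eq_of_rel {V : Type*} {p : Perm V} (hp : IsPairing p) {a b : V}
    (hab : a ≠ b) (h : SameCycle.setoid p a b) : p a = b := by
  rcases hp.rel_iff.1 h with h | h
  · exact absurd h.symm hab
  · exact h.symm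

theorem IsNRelation.edge_eq_of_mem {V : Type*} {m : Setoid V} (hm : IsNRelation 2 m)
    {e f : Sym2 V} (he : ¬e.IsDiag) (hf : ¬f.IsDiag) (hme : m.ContainsEdge e)
    (hmf : m.ContainsEdge f) {v : V} (hve : v ∈ e) (hvf : v ∈ f) : e = f := by
  obtain ⟨p, hp, rfl⟩ := hm.exists_isPairing
  obtain ⟨x, rfl⟩ := Sym2.mem_iff_exists.1 hve
  obtain ⟨y, rfl⟩ := Sym2.mem_iff_exists.1 hvf
  rw [Setoid.containsEdge_mk] at hme hmf
  rw [← hp.apply_eq_of_rel (by simpa using he) hme, ← hp.apply_eq_of_rel (by simpa using hf) hmf]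

theorem exists_isPairing_of_ne {V : Type*} [Infinite V] {a b c d : V} (hab : a ≠ b) (hac : a ≠ c)
    (had : a ≠ d) (hbc : b ≠ c) (hbd : b ≠ d) (hcd : c ≠ d) :
    ∃ m : Perm V, IsPairing m ∧ m a = b ∧ m c = d := by
  obtain ⟨m, hm, -, h⟩ := exists_isPairing_extending_pairs (1 : Perm V) (fun _ => rfl)
    (by simpa using Set.infinite_univ) (a := a) (b := b) (c := c) (d := d) rfl rfl rfl rfl
    hab hac had hbc hbd hcd
  exact ⟨m, hm, h⟩

theorem IsPairing.rel_apply {V : Type*} {p : Perm V} (hp : IsPairing p) (x : V) :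
    SameCycle.setoid p x (p x) :=
  hp.rel_iff.2 (Or.inr rfl)

theorem exists_isPairing_containsEdge {V : Type*} [Infinite V] {e f : Sym2 V} (he : ¬e.IsDiag)
    (hf : ¬f.IsDiag) (hef : ¬∃ v, v ∈ e ∧ v ∈ f) :
    ∃ p : Perm V, IsPairing p ∧ (SameCycle.setoid p).ContainsEdge e ∧
      (SameCycle.setoid p).ContainsEdge f := by
  induction e with
  | _ a b =>
  induction f with
  | _ c d =>
  have h : ∀ v, v ∈ s(a, b) → v ∉ s(c, d) := fun v h1 h2 => hef ⟨v, h1, h2⟩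
  have ha := h a (by simp)
  have hb := h b (by simp)
  simp only [Sym2.mem_iff, not_or] at ha hb
  obtain ⟨m, hm, h1, h2⟩ := exists_isPairing_of_ne (by simpa using he) ha.1 ha.2 hb.1 hb.2
    (by simpa using hf)
  refine ⟨m, hm, Setoid.containsEdge_mk.2 ?_, Setoid.containsEdge_mk.2 ?_⟩
  · rw [← h1]; exact hm.rel_apply a
  · rw [← h2]; exact hm.rel_apply c

/-- If `e` and `f` share a vertex, one matching through `e` contains both, which forces equality. If
they are disjoint, a matching through `e` can send an end of `f` to a fresh point, so it omits `f`.
-/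
theorem edge_eq_of_forall_isPairing {V : Type*} [Infinite V] {e f : Sym2 V} (he : ¬e.IsDiag)
    (hf : ¬f.IsDiag) (h : ∀ p : Perm V, IsPairing p → (SameCycle.setoid p).ContainsEdge e →
      (SameCycle.setoid p).ContainsEdge f) : e = f := by
  by_cases hef : ∃ v, v ∈ e ∧ v ∈ f
  · obtain ⟨v, hve, hvf⟩ := hef
    induction e with
    | _ a b =>
    obtain ⟨c, hc⟩ := (Set.toFinite {a, b}).exists_notMem
    obtain ⟨d, hd⟩ := (Set.toFinite {a, b, c}).exists_notMem
    simp only [Set.mem_insert_iff, Set.mem_singleton_iff, not_or] at hc hd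
    obtain ⟨p, hp, hpe, -⟩ := exists_isPairing_containsEdge (e := s(a, b)) (f := s(c, d)) he
      (by simpa using Ne.symm hd.2.2) (by
        rintro ⟨w, h1, h2⟩
        simp only [Sym2.mem_iff] at h1 h2
        grind)
    exact hp.isNRelation.edge_eq_of_mem he hf hpe (h p hp hpe) hve hvf
  · exfalso
    induction e with
    | _ a b =>
    induction f with
    | _ c d =>
    obtain ⟨x, hx⟩ := (Set.toFinite {a, b, c, d}).exists_notMem
    simp only [Set.mem_insert_iff, Set.mem_singleton_iff, not_or] at hx
    have hcd : c ≠ d := by simpa using hf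
    obtain ⟨p, hp, hpe, hpf⟩ := exists_isPairing_containsEdge (e := s(a, b)) (f := s(c, x)) he
      (by simpa using Ne.symm hx.2.2.1) (by
        rintro ⟨w, h1, h2⟩
        rcases Sym2.mem_iff.1 h2 with rfl | rfl
        · exact hef ⟨w, h1, by simp⟩
        · rcases Sym2.mem_iff.1 h1 with rfl | rfl
          · exact hx.1 rfl
          · exact hx.2.1 rfl)
    have h1 := h p hp hpe
    rw [Setoid.containsEdge_mk] at h1 hpf
    have h2 := hp.apply_eq_of_rel hcd h1
    have h3 := hp.apply_eq_of_rel (Ne.symm hx.2.2.1) hpf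
    exact hx.2.2.2 (h3.symm.trans h2)

theorem exists_edge_map {T V W : Type*} [Nonempty W] {f : T → Setoid V}
    {g : T → Setoid W} (hfg : ∀ a b, a ≠ b → ∃ c d, c ≠ d ∧ ∀ t, f t a b → g t c d) :
    ∃ F : Sym2 V → Sym2 W, ∀ e, ¬e.IsDiag → ¬(F e).IsDiag ∧
      ∀ t, (f t).ContainsEdge e → (g t).ContainsEdge (F e) := by
  have key : ∀ e : Sym2 V, ∃ e' : Sym2 W, ¬e.IsDiag → ¬e'.IsDiag ∧
      ∀ t, (f t).ContainsEdge e → (g t).ContainsEdge e' := by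
    intro e
    induction e with
    | _ a b =>
    by_cases hab : a = b
    -- On diagonal elements the value is irrelevant.
    · exact ⟨s(Classical.arbitrary W, Classical.arbitrary W), fun h => absurd hab (by simpa using h)⟩
    · obtain ⟨c, d, hcd, h⟩ := hfg a b hab
      refine ⟨s(c, d), fun _ => ⟨by simpa using hcd, fun t => ?_⟩⟩
      rw [Setoid.containsEdge_mk, Setoid.containsEdge_mk]
      exact h t
  choose F hF using key
  exact ⟨F, hF⟩

/-- Two families of 2-relations, each containing all 2-relations, are related by a bijection
of the underlying sets if the edges can be translated in both directions. -/
theorem exists_equiv_of_edge_maps {T V W : Type*} [Infinite V] [Infinite W] (f : T → Setoid V)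
    (g : T → Setoid W) (hf : ∀ t, IsNRelation 2 (f t)) (hg : ∀ t, IsNRelation 2 (g t))
    (hf' : ∀ m, IsNRelation 2 m → ∃ t, f t = m) (hg' : ∀ m, IsNRelation 2 m → ∃ t, g t = m)
    (hfg : ∀ a b, a ≠ b → ∃ c d, c ≠ d ∧ ∀ t, f t a b → g t c d)
    (hgf : ∀ c d, c ≠ d → ∃ a b, a ≠ b ∧ ∀ t, g t c d → f t a b) :
    ∃ τ : V ≃ W, ∀ t a b, f t a b ↔ g t (τ a) (τ b) := by
  obtain ⟨F, hF⟩ := exists_edge_map hfg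
  obtain ⟨G, hG⟩ := exists_edge_map hgf
  have hGF : ∀ e, ¬e.IsDiag → G (F e) = e := by
    intro e he
    refine (edge_eq_of_forall_isPairing he (hG _ (hF e he).1).1 fun p hp hpe => ?_).symm
    obtain ⟨t, ht⟩ := hf' _ hp.isNRelation
    rw [← ht] at hpe ⊢
    exact (hG _ (hF e he).1).2 t ((hF e he).2 t hpe)
  have hFG : ∀ e, ¬e.IsDiag → F (G e) = e := by
    intro e he
    refine (edge_eq_of_forall_isPairing he (hF _ (hG e he).1).1 fun p hp hpe => ?_).symm
    obtain ⟨t, ht⟩ := hg' _ hp.isNRelation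
    rw [← ht] at hpe ⊢
    exact (hF _ (hG e he).1).2 t ((hG e he).2 t hpe)
  have hiff : ∀ t e, ¬e.IsDiag → ((f t).ContainsEdge e ↔ (g t).ContainsEdge (F e)) :=
    fun t e he => ⟨(hF e he).2 t, fun h => hGF e he ▸ (hG _ (hF e he).1).2 t h⟩
  have hinj : ∀ e f, ¬e.IsDiag → ¬f.IsDiag → F e = F f → e = f := fun e f he hf h => by
    rw [← hGF e he, h, hGF f hf]
  obtain ⟨τ, hτ, hFτ⟩ := exists_vertex_map F (fun e he => (hF e he).1) hinj (by
    intro e e' he he'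
    by_cases hee : e = e'
    · subst hee
      exact ⟨fun _ => ⟨_, Sym2.out_fst_mem _, Sym2.out_fst_mem _⟩,
        fun _ => ⟨_, Sym2.out_fst_mem _, Sym2.out_fst_mem _⟩⟩
    constructor
    · rintro ⟨v, hv, hv'⟩
      -- Disjoint images would lie in a common matching of the second family; pulled back, it would
      -- contain two distinct edges through `v`.
      by_contra hcon
      obtain ⟨p, hp, h1, h2⟩ := exists_isPairing_containsEdge (hF e he).1 (hF e' he').1 hcon
      obtain ⟨t, ht⟩ := hg' _ hp.isNRelation
      rw [← ht, ← hiff t _ ‹_›] at h1 h2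
      exact hee ((hf t).edge_eq_of_mem he he' h1 h2 hv hv')
    · rintro ⟨v, hv, hv'⟩
      by_contra hcon
      obtain ⟨p, hp, h1, h2⟩ := exists_isPairing_containsEdge he he' hcon
      obtain ⟨t, ht⟩ := hf' _ hp.isNRelation
      rw [← ht, hiff t _ ‹_›] at h1 h2
      exact hee (hinj e e' he he'
        ((hg t).edge_eq_of_mem (hF e he).1 (hF e' he').1 h1 h2 hv hv')))
  have hsurj : Function.Surjective τ := by
    intro w
    obtain ⟨z, hz⟩ := exists_ne w
    have hd : ¬(s(w, z)).IsDiag := by simpa using hz.symm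
    have h1 := hFG _ hd
    have h2 := (hG _ hd).1
    generalize G s(w, z) = e at h1 h2
    induction e with
    | _ a b =>
    rw [hFτ a b (by simpa using h2)] at h1
    have hw : w ∈ s(τ a, τ b) := by simp [h1]
    rcases Sym2.mem_iff.1 hw with rfl | rfl
    · exact ⟨a, rfl⟩
    · exact ⟨b, rfl⟩
  refine ⟨Equiv.ofBijective τ ⟨hτ, hsurj⟩, fun t a b => ?_⟩
  by_cases hab : a = b
  · subst hab
    exact ⟨fun _ => (g t).refl' _, fun _ => (f t).refl' _⟩
  · rw [← Setoid.containsEdge_mk, hiff t _ (by simpa using hab), hFτ a b hab,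
      Setoid.containsEdge_mk]
    rfl

/-! ### 4-relations above a 2-relation as 2-relations on its quotient. -/

theorem IsNRelation.encard_preimage_mk {X : Type*} {π : Setoid X} (hπ : IsNRelation 2 π)
    (C : Set (Quotient π)) : (Quotient.mk π ⁻¹' C).encard = 2 * C.encard := by
  obtain ⟨p, hp, rfl⟩ := hπ.exists_isPairing
  set q := Quotient.mk (SameCycle.setoid p)
  have hq : ∀ v, q v.out = v := Quotient.out_eq
  have hqp : ∀ x, q (p x) = q x := fun x => (Quotient.sound (hp.rel_apply x)).symm
  -- The preimage is covered by two disjoint sections, one consisting of the chosen representatives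
  -- and the other of their partners.
  have hu : q ⁻¹' C = Quotient.out '' C ∪ (fun v => p v.out) '' C := by
    ext x
    constructor
    · intro hx
      have h1 : SameCycle.setoid p (q x).out x := Quotient.exact (hq (q x))
      rcases hp.rel_iff.1 h1 with h | h
      · exact Or.inl ⟨q x, hx, h.symm⟩
      · exact Or.inr ⟨q x, hx, h.symm⟩
    · rintro (⟨v, hv, rfl⟩ | ⟨v, hv, rfl⟩)
      · simpa [hq] using hv
      · simpa [hqp, hq] using hv
  have hdisj : Disjoint (Quotient.out '' C) ((fun v => p v.out) '' C) := by
    rw [Set.disjoint_left]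
    rintro _ ⟨v, -, rfl⟩ ⟨w, -, h⟩
    have h1 : w = v := by
      rw [← hq w, ← hq v, ← hqp w.out]
      exact congrArg q h
    subst h1
    exact hp.ne _ h
  have hinj : Function.Injective (fun v : Quotient (SameCycle.setoid p) => p v.out) :=
    p.injective.comp Quotient.out_injective
  rw [hu, Set.encard_union_eq hdisj, Quotient.out_injective.encard_image, hinj.encard_image,
    two_mul]

theorem IsNRelation.finite_preimage_mk {X : Type*} {π : Setoid X} (hπ : IsNRelation 2 π)
    {C : Set (Quotient π)} (hC : C.Finite) : (Quotient.mk π ⁻¹' C).Finite := by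
  rw [← Set.encard_lt_top_iff, hπ.encard_preimage_mk, two_mul]
  exact ENat.add_lt_top.2 ⟨hC.encard_lt_top, hC.encard_lt_top⟩

theorem IsNRelation.infinite_quotient {X : Type*} [Infinite X] {π : Setoid X}
    (hπ : IsNRelation 2 π) : Infinite (Quotient π) := by
  rw [← Set.infinite_univ_iff]
  exact fun h => Set.infinite_univ (hπ.finite_preimage_mk h)

theorem IsNRelation.comap_mk_iff {X : Type*} {π : Setoid X} (hπ : IsNRelation 2 π)
    {m : Setoid (Quotient π)} :
    IsNRelation 4 (m.comap (Quotient.mk π)) ↔ IsNRelation 2 m := by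
  have key : ∀ x, {y | m.comap (Quotient.mk π) y x}.encard
      = 2 * {v | m v (Quotient.mk π x)}.encard := fun x =>
    hπ.encard_preimage_mk {v | m v (Quotient.mk π x)}
  have h4 : ((4 : ℕ) : ℕ∞) = 2 * ((2 : ℕ) : ℕ∞) := by norm_num
  rw [isNRelation_iff, isNRelation_iff]
  constructor
  · intro h v
    induction v using Quotient.inductionOn with
    | _ x =>
    have h1 := h x
    rw [key, h4] at h1
    exact (ENat.mul_right_strictMono (by decide) (by decide)).injective h1
  · intro h x
    rw [key, h, h4]

/-- The relation induced on the quotient by a finer relation. -/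
def Setoid.quotientRel {X : Type*} {π θ : Setoid X} (h : π ≤ θ) : Setoid (Quotient π) :=
  Setoid.ker (Quotient.map' id h : Quotient π → Quotient θ)

theorem Setoid.quotientRel_mk {X : Type*} {π θ : Setoid X} (h : π ≤ θ) {x y : X} :
    Setoid.quotientRel h (Quotient.mk π x) (Quotient.mk π y) ↔ θ x y :=
  Quotient.eq''

theorem Setoid.comap_quotientRel {X : Type*} {π θ : Setoid X} (h : π ≤ θ) :
    (Setoid.quotientRel h).comap (Quotient.mk π) = θ := by
  ext x y
  exact Setoid.quotientRel_mk h

theorem Setoid.le_comap_mk {X : Type*} {π : Setoid X} (m : Setoid (Quotient π)) :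
    π ≤ m.comap (Quotient.mk π) := by
  intro x y h
  change m _ _
  rw [Quotient.sound h]

theorem Setoid.quotientRel_comap {X : Type*} {π : Setoid X} (m : Setoid (Quotient π)) :
    Setoid.quotientRel (Setoid.le_comap_mk m) = m := by
  ext v w
  induction v, w using Quotient.inductionOn₂ with
  | _ x y => exact Setoid.quotientRel_mk _

theorem IsNRelation.quotientRel {X : Type*} {π θ : Setoid X} (hπ : IsNRelation 2 π)
    (hθ : IsNRelation 4 θ) (h : π ≤ θ) : IsNRelation 2 (Setoid.quotientRel h) := by
  rwa [← hπ.comap_mk_iff, Setoid.comap_quotientRel]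

/-! ### The bijection between the blocks of a 2-relation and those of its image. -/

theorem IsPairing.exists_rel_not_rel {X : Type*} {p q : Perm X} (hp : IsPairing p) (hq : IsPairing q)
    (h : SameCycle.setoid p ≠ SameCycle.setoid q) :
    ∃ x y, SameCycle.setoid q x y ∧ ¬SameCycle.setoid p x y := by
  by_contra! hcon
  apply h
  congr 1
  ext x
  rcases hp.rel_iff.1 (hcon x _ (hq.rel_apply x)) with h1 | h1
  · exact absurd h1 (hq.ne x)
  · exact h1.symm

/-- Two unrelated points of a 2-relation `π` can be separated from `π` by a 2-relation contained
in each relation above `π` relating them. -/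
theorem IsNRelation.exists_switch {X : Type*} {π : Setoid X} (hπ : IsNRelation 2 π) {x y : X}
    (hxy : ¬π x y) : ∃ π' : Setoid X, IsNRelation 2 π' ∧ π' ≠ π ∧
      ∀ θ : Setoid X, π ≤ θ → θ x y → π' ≤ θ := by
  classical
  obtain ⟨p, hp, rfl⟩ := hπ.exists_isPairing
  -- This conjugate replaces the blocks `{x, p x}` and `{y, p y}` by `{x, y}` and `{p x, p y}`,
  -- whose union lies in one class of any `θ` as required.
  have hc := hp.conj (swap (p x) y)
  have hyx : y ≠ x ∧ y ≠ p x := by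
    rw [hp.rel_iff] at hxy
    tauto
  refine ⟨_, hc.isNRelation, fun h => hxy ?_, fun θ hθ hθxy => ?_⟩
  · rw [← h, hc.rel_iff]
    right
    simp [swap_apply_of_ne_of_ne (hp.ne x).symm hyx.1.symm]
  · have hs : ∀ z, θ (swap (p x) y z) z := by
      have h1 : θ (p x) y := θ.trans' (θ.symm' (hθ (hp.rel_apply x))) hθxy
      intro z
      by_cases hz1 : z = p x
      · subst hz1; rw [swap_apply_left]; exact θ.symm' h1
      by_cases hz2 : z = y
      · subst hz2; rw [swap_apply_right]; exact h1
      rw [swap_apply_of_ne_of_ne hz1 hz2]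
    intro u v huv
    rcases hc.rel_iff.1 huv with rfl | rfl
    · exact θ.refl' _
    · apply θ.symm'
      simp only [Perm.mul_apply, swap_inv]
      exact θ.trans' (hs _) (θ.trans' (θ.symm' (hθ (hp.rel_apply _))) (hs _))

/-- The switched relation `π'` lies below every `θ` in question, so `β π'` lies below `β θ`. Since
`β π'` and `β π` are distinct 2-relations, some pair in the former is missing from the latter, and
it serves for all `θ` at once. -/
theorem IsSizePreserving.exists_edge {X : Type*} {β : EqStar X ≃o EqStar X} (hβ : IsSizePreserving β) {π : EqStar X}
    (hπ : IsNRelation 2 π.1) {x y : X} (hxy : ¬π.1 x y) :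
    ∃ z w, ¬(β π).1 z w ∧ ∀ θ, π ≤ θ → θ.1 x y → (β θ).1 z w := by
  obtain ⟨π', hπ', hne, h⟩ := hπ.exists_switch hxy
  have hne' : (β π).1 ≠ (β ⟨π', 2, hπ'⟩).1 := by
    intro h1
    apply hne
    have h2 := β.injective (Subtype.ext h1)
    exact (congrArg Subtype.val h2).symm
  obtain ⟨p, hp, hpe⟩ := (hβ 2 π hπ).exists_isPairing
  obtain ⟨q, hq, hqe⟩ := (hβ 2 ⟨π', 2, hπ'⟩ hπ').exists_isPairing
  rw [← hpe, ← hqe] at hne'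
  obtain ⟨z, w, h1, h2⟩ := hp.exists_rel_not_rel hq hne'
  refine ⟨z, w, by rwa [← hpe], fun θ hθ hθxy => ?_⟩
  have h3 : β ⟨π', 2, hπ'⟩ ≤ β θ := β.monotone (h θ.1 hθ hθxy)
  apply h3
  rwa [← hqe]

section

variable {X : Type*} [Infinite X] {β : EqStar X ≃o EqStar X}

theorem IsSizePreserving.symm (hβ : IsSizePreserving β) : IsSizePreserving β.symm := by
  intro n θ hθ
  obtain ⟨k, hk⟩ := (β.symm θ).2
  have h1 := hβ k _ hk
  rw [OrderIso.apply_symm_apply] at h1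
  rwa [← h1.unique hθ]

/-- An automorphism induces, for each 2-relation, a bijection between the blocks of the
2-relation and those of its image. -/
theorem IsSizePreserving.exists_quotient_equiv (hβ : IsSizePreserving β) {π : EqStar X}
    (hπ : IsNRelation 2 π.1) :
    ∃ τ : Quotient π.1 ≃ Quotient (β π).1, ∀ θ, π ≤ θ → IsNRelation 4 θ.1 → ∀ x y z w,
      τ (Quotient.mk _ x) = Quotient.mk _ z → τ (Quotient.mk _ y) = Quotient.mk _ w →
      (θ.1 x y ↔ (β θ).1 z w) := by
  have hπ' := hβ 2 π hπ
  have := hπ.infinite_quotient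
  have := hπ'.infinite_quotient
  obtain ⟨τ, hτ⟩ := exists_equiv_of_edge_maps
    (T := {θ : EqStar X // π ≤ θ ∧ IsNRelation 4 θ.1})
    (fun t => Setoid.quotientRel (π := π.1) (θ := t.1.1) t.2.1)
    (fun t => Setoid.quotientRel (π := (β π).1) (θ := (β t.1).1) (β.monotone t.2.1))
    (fun t => hπ.quotientRel t.2.2 _) (fun t => hπ'.quotientRel (hβ 4 _ t.2.2) _)
    (fun m hm => ⟨⟨⟨_, 4, hπ.comap_mk_iff.2 hm⟩, Setoid.le_comap_mk m, hπ.comap_mk_iff.2 hm⟩,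
      Setoid.quotientRel_comap m⟩)
    (fun m hm => by
      have h4 := hπ'.comap_mk_iff.2 hm
      refine ⟨⟨β.symm ⟨_, 4, h4⟩, ?_, hβ.symm 4 _ h4⟩, ?_⟩
      · rw [OrderIso.le_symm_apply]
        exact Setoid.le_comap_mk m
      · convert Setoid.quotientRel_comap m using 2; simp)
    (by
      intro a b hab
      induction a, b using Quotient.inductionOn₂ with
      | _ x y =>
      obtain ⟨z, w, hzw, h⟩ := hβ.exists_edge hπ (fun h => hab (Quotient.sound h))
      refine ⟨Quotient.mk _ z, Quotient.mk _ w, fun h => hzw (Quotient.exact h), fun t ht => ?_⟩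
      rw [Setoid.quotientRel_mk] at ht ⊢
      exact h t.1 t.2.1 ht)
    (by
      intro a b hab
      induction a, b using Quotient.inductionOn₂ with
      | _ x y =>
      obtain ⟨z, w, hzw, h⟩ := hβ.symm.exists_edge hπ' (fun h => hab (Quotient.sound h))
      rw [OrderIso.symm_apply_apply] at hzw
      refine ⟨Quotient.mk _ z, Quotient.mk _ w, fun h => hzw (Quotient.exact h), fun t ht => ?_⟩
      rw [Setoid.quotientRel_mk] at ht ⊢
      have h1 := h (β t.1) (β.monotone t.2.1) ht
      rwa [OrderIso.symm_apply_apply] at h1)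
  refine ⟨τ, fun θ hθ h4 x y z w hx hy => ?_⟩
  have h := hτ ⟨θ, hθ, h4⟩ (Quotient.mk _ x) (Quotient.mk _ y)
  rwa [hx, hy, Setoid.quotientRel_mk, Setoid.quotientRel_mk] at h

end

/-! ### Dihedral orbits of two pairings. -/

theorem IsPairing.apply_zpow_mul {V : Type*} {p q : Perm V} (hp : IsPairing p) (hq : IsPairing q)
    (k : ℤ) (x : V) : p (((q * p) ^ k) x) = ((q * p) ^ (-k)) (p x) := by
  have hpp : p⁻¹ = p := by
    ext y
    rw [Perm.inv_eq_iff_eq, hp.sq]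
  have hqq : q⁻¹ = q := by
    ext y
    rw [Perm.inv_eq_iff_eq, hq.sq]
  have h1 : p * (q * p) * p⁻¹ = (q * p)⁻¹ := by
    rw [mul_inv_rev, hpp, hqq]
    ext y
    simp [hp.sq]
  have h2 : p * (q * p) ^ k * p⁻¹ = (q * p) ^ (-k) := by
    rw [← conj_zpow, h1, inv_zpow, zpow_neg]
  rw [← h2]
  simp

theorem IsPairing.not_sameCycle_mul {V : Type*} {p q : Perm V} (hp : IsPairing p)
    (hq : IsPairing q) (x : V) : ¬(q * p).SameCycle x (p x) := by
  rintro ⟨k, hk⟩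
  have hz := hp.apply_zpow_mul hq
  -- The reflection `p` would reverse the cycle of `x`; according to the parity of `k`, its midpoint
  -- yields a fixed point of `p` or of `q`.
  rcases Int.even_or_odd' k with ⟨j, rfl | rfl⟩
  · apply hp.ne (((q * p) ^ j) x)
    rw [hz, ← hk, ← Perm.mul_apply, ← zpow_add]
    congr 2
    ring
  · apply hq.ne (p (((q * p) ^ j) x))
    rw [← Perm.mul_apply q p, ← Perm.mul_apply, ← zpow_one_add, hz, ← hk, ← Perm.mul_apply,
      ← zpow_add]
    congr 2
    ring

theorem IsPairing.sameCycle_mul_apply {V : Type*} {p q : Perm V} (hp : IsPairing p)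
    (hq : IsPairing q) {x y : V} (h : (q * p).SameCycle x y) : (q * p).SameCycle (p x) (p y) := by
  obtain ⟨k, rfl⟩ := h
  exact ⟨-k, (hp.apply_zpow_mul hq k x).symm⟩

/-- The orbit relation of the group generated by two pairings. -/
def IsPairing.orbitSetoid {V : Type*} {p q : Perm V} (hp : IsPairing p) (hq : IsPairing q) :
    Setoid V where
  r x y := (q * p).SameCycle x y ∨ (q * p).SameCycle x (p y)
  iseqv := by
    have hpp : ∀ {x y}, (q * p).SameCycle x (p y) → (q * p).SameCycle (p x) y := fun {x y} h => by
      simpa [hp.sq] using hp.sameCycle_mul_apply hq h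
    refine ⟨fun x => Or.inl (SameCycle.refl _ _), ?_, ?_⟩
    · rintro x y (h | h)
      · exact Or.inl h.symm
      · exact Or.inr (hpp h).symm
    · rintro x y z (h | h) (h' | h')
      · exact Or.inl (h.trans h')
      · exact Or.inr (h.trans h')
      · exact Or.inr (h.trans (hp.sameCycle_mul_apply hq h'))
      · exact Or.inl (h.trans (hpp h'))

/-- Two pairings both commute with some third pairing, which may be taken to agree with them
at a given point where they coincide. -/
theorem IsPairing.exists_commute {V : Type*} {p q : Perm V} (hp : IsPairing p)
    (hq : IsPairing q) {x₀ : V} (hx₀ : p x₀ = q x₀) :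
    ∃ c : Perm V, IsPairing c ∧ (∀ x, p (c x) = c (p x)) ∧ (∀ x, q (c x) = c (q x)) ∧
      c x₀ = p x₀ := by
  set g := q * p with hg
  have hz : ∀ (k : ℤ) x, p ((g ^ k) x) = (g ^ (-k)) (p x) := hp.apply_zpow_mul hq
  let base : V → V := fun x => (Quotient.mk (hp.orbitSetoid hq) x).out
  have hbase : ∀ x y, hp.orbitSetoid hq x y → base x = base y := fun x y h =>
    congrArg Quotient.out (Quotient.sound h)
  have hrep : ∀ x, ∃ k : ℤ, ∃ e, (e = base x ∨ e = p (base x)) ∧ (g ^ k) e = x := by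
    intro x
    have h1 : hp.orbitSetoid hq x (base x) :=
      (hp.orbitSetoid hq).symm' (Quotient.exact (Quotient.out_eq _))
    rcases h1 with h | h
    · obtain ⟨k, hk⟩ := h.symm
      exact ⟨k, _, Or.inl rfl, hk⟩
    · obtain ⟨k, hk⟩ := h.symm
      exact ⟨k, _, Or.inr rfl, hk⟩
  have hrep' := hrep
  choose κ ε hε hκ using hrep
  -- With `x = g ^ κ x (ε x)` this equals `g ^ κ x (p (ε x))`: the analogue of right multiplication
  -- by `p` on a dihedral orbit, which commutes with the left action. By `hc` it does not depend on
  -- the exponent, because `base x` and `p (base x)` lie in different cycles of `g`.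
  let c : V → V := fun x => p ((g ^ (-(2 * κ x))) x)
  have hc : ∀ x (k : ℤ) e, (e = base x ∨ e = p (base x)) → (g ^ k) e = x →
      c x = (g ^ k) (p e) := by
    intro x k e he hx
    have hee : ε x = e := by
      have hsc : g.SameCycle (ε x) e := SameCycle.trans ⟨κ x, hκ x⟩ (SameCycle.symm ⟨k, hx⟩)
      have hn := hp.not_sameCycle_mul hq (base x)
      rcases hε x with h1 | h1 <;> rcases he with h2 | h2
      · rw [h1, h2]
      · rw [h1, h2] at hsc; exact absurd hsc hn
      · rw [h1, h2] at hsc; exact absurd hsc.symm hn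
      · rw [h1, h2]
    have h1 : (g ^ (-(2 * κ x))) x = (g ^ (-κ x)) e := by
      have h0 : x = (g ^ κ x) e := by rw [← hee, hκ]
      generalize κ x = j at h0 ⊢
      rw [h0, ← Perm.mul_apply, ← zpow_add]
      congr 2
      ring
    have h2 : (g ^ (-κ x)) e = (g ^ (-k)) e := by
      have h3 : (g ^ (-k - κ x)) ((g ^ k) e) = (g ^ (-k - κ x)) ((g ^ (κ x)) e) := by
        rw [hx, ← hee, hκ]
      rw [← Perm.mul_apply, ← Perm.mul_apply, ← zpow_add, ← zpow_add] at h3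
      convert h3 using 3 <;> ring
    change p _ = _
    rw [h1, h2, hz, neg_neg]
  have hcp : ∀ x, p (c x) = c (p x) := by
    intro x
    obtain ⟨k, e, he, hx⟩ := hrep' x
    have hb : base (p x) = base x := hbase _ _ (Or.inr (SameCycle.refl _ _))
    rw [hc x k e he hx, hc (p x) (-k) (p e) ?_ ?_, hz]
    · rw [hb]
      rcases he with rfl | rfl
      · exact Or.inr rfl
      · exact Or.inl (hp.sq _)
    · rw [← hx, hz]
  have hcg : ∀ x, g (c x) = c (g x) := by
    intro x
    obtain ⟨k, e, he, hx⟩ := hrep' x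
    have hb : base (g x) = base x := hbase _ _ (Or.inl (SameCycle.symm ⟨1, by rw [zpow_one]⟩))
    have h1 : (g ^ (1 + k)) e = g x := by
      rw [zpow_one_add, ← hx]
      rfl
    rw [hc x k e he hx, hc (g x) (1 + k) e (by rwa [hb]) h1, zpow_one_add]
    rfl
  have hcc : Function.Involutive c := by
    intro x
    obtain ⟨k, e, he, hx⟩ := hrep' x
    have h1 := hc x k e he hx
    have hb : base (c x) = base x := by
      refine hbase _ _ (Or.inr (hp.sameCycle_mul_apply hq ?_))
      exact SameCycle.symm ⟨-(2 * κ x), rfl⟩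
    rw [hc (c x) k (p e) ?_ h1.symm, hp.sq, hx]
    rw [hb]
    rcases he with rfl | rfl
    · exact Or.inr rfl
    · exact Or.inl (hp.sq _)
  refine ⟨hcc.toPerm c, ⟨hcc, fun x hx => ?_⟩, hcp, fun x => ?_, ?_⟩
  · obtain ⟨k, e, he, hxe⟩ := hrep' x
    change c x = x at hx
    rw [hc x k e he hxe, ← hxe] at hx
    exact hp.ne e ((g ^ k).injective hx)
  · have h1 := hcg (p x)
    rw [← hcp, hg, Perm.mul_apply, Perm.mul_apply, hp.sq, hp.sq] at h1
    exact h1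
  · obtain ⟨k, e, he, hxe⟩ := hrep' x₀
    have hgx : g x₀ = x₀ := by rw [hg, Perm.mul_apply, hx₀, hq.sq]
    have h1 : (g ^ (-k)) x₀ = x₀ := zpow_apply_eq_self_of_apply_eq_self hgx _
    have h2 : e = x₀ := by
      rw [← h1, ← hxe, ← Perm.mul_apply, ← zpow_add]
      simp
    rw [h2] at he
    have h3 := hc x₀ 0 x₀ he rfl
    exact h3

/-- The conjugation trades the blocks `{a, b}` and `{c, d}` for `{a, c}` and `{b, d}` and leaves all
others alone. -/
theorem IsPairing.conj_swap_apply_ne_iff {V : Type*} [DecidableEq V] {m : Perm V}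
    (hm : IsPairing m) {a b c d : V} (hab : m a = b) (hcd : m c = d) (hbc : b ≠ c) (had : a ≠ d)
    (hac : a ≠ c) (v : V) :
    (swap b c * m * (swap b c)⁻¹) v ≠ m v ↔ v = a ∨ v = b ∨ v = c ∨ v = d := by
  have hba : m b = a := by rw [← hab, hm.sq]
  have hdc : m d = c := by rw [← hcd, hm.sq]
  have hab' : a ≠ b := fun h => hm.ne a (hab.trans h.symm)
  have hcd' : c ≠ d := fun h => hm.ne c (hcd.trans h.symm)
  have hbd : b ≠ d := fun h => hac (by rw [← hba, ← hdc, h])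
  simp only [swap_inv, Perm.mul_apply]
  constructor
  · contrapose!
    rintro ⟨h1, h2, h3, h4⟩
    rw [swap_apply_of_ne_of_ne h2 h3, swap_apply_of_ne_of_ne]
    · rintro h
      exact h1 (by rw [← hm.sq v, h, hba])
    · rintro h
      exact h4 (by rw [← hm.sq v, h, hcd])
  · rintro (rfl | rfl | rfl | rfl)
    · rw [swap_apply_of_ne_of_ne hab' hac, hab, swap_apply_left]
      exact hbc.symm
    · rw [swap_apply_left, hcd, swap_apply_of_ne_of_ne hbd.symm hcd'.symm, hba]
      exact had.symm
    · rw [swap_apply_right, hba, swap_apply_of_ne_of_ne hab' hac, hcd]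
      exact had
    · rw [swap_apply_of_ne_of_ne hbd.symm hcd'.symm, hdc, swap_apply_right]
      exact hbc

/-! ### 4-relations above two commuting pairings, and intermediate pairings. -/

/-- The points at which two equivalence relations have different classes. -/
def Setoid.differSet {X : Type*} (θ θ' : Setoid X) : Set X :=
  {x | ∃ y, ¬(θ x y ↔ θ' x y)}

/-- Two commuting pairings with infinitely many common blocks lie below two 4-relations
which differ exactly on four given common blocks. -/
theorem IsPairing.exists_differSet_eq {X : Type*} {p q : Perm X} (hp : IsPairing p)
    (hq : IsPairing q) (hpq : ∀ x, p (q x) = q (p x)) (hinf : {x | p x = q x}.Infinite)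
    {a b c d : X} (ha : p a = q a) (hb : p b = q b) (hc : p c = q c) (hd : p d = q d)
    (hab : ¬SameCycle.setoid p a b) (hac : ¬SameCycle.setoid p a c)
    (had : ¬SameCycle.setoid p a d) (hbc : ¬SameCycle.setoid p b c)
    (hbd : ¬SameCycle.setoid p b d) (hcd : ¬SameCycle.setoid p c d) :
    ∃ θ θ' : Setoid X, IsNRelation 4 θ ∧ IsNRelation 4 θ' ∧ SameCycle.setoid p ≤ θ ∧
      SameCycle.setoid p ≤ θ' ∧ SameCycle.setoid q ≤ θ ∧ SameCycle.setoid q ≤ θ' ∧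
      ∀ x, x ∈ θ.differSet θ' ↔ SameCycle.setoid p x a ∨ SameCycle.setoid p x b ∨
        SameCycle.setoid p x c ∨ SameCycle.setoid p x d := by
  classical
  -- `q` acts on the blocks of `p`, and the fixed blocks are the common ones. A matching that
  -- extends the moved part of `P` pulls back to a 4-relation above both pairings.
  let P : Perm (Quotient (SameCycle.setoid p)) := Quotient.congr q (by
    intro x y
    change SameCycle.setoid p x y ↔ SameCycle.setoid p (q x) (q y)
    rw [hp.rel_iff, hp.rel_iff, hpq, q.injective.eq_iff, q.injective.eq_iff])
  have hPmk : ∀ x, P (Quotient.mk _ x) = Quotient.mk _ (q x) := fun x => rfl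
  have hP : ∀ v, P (P v) = v := by
    intro v
    induction v using Quotient.inductionOn with
    | _ x => rw [hPmk, hPmk, hq.sq]
  have hfix : ∀ x, P (Quotient.mk _ x) = Quotient.mk _ x ↔ p x = q x := by
    intro x
    rw [hPmk, eq_comm, Quotient.eq, hp.rel_iff]
    simp [hq.ne, eq_comm]
  have hfixinf : {v | P v = v}.Infinite := by
    intro h
    refine hinf ((hp.isNRelation.finite_preimage_mk h).subset fun x hx => ?_)
    exact (hfix x).2 hx
  have hmk : ∀ {x y : X}, ¬SameCycle.setoid p x y →
      Quotient.mk (SameCycle.setoid p) x ≠ Quotient.mk _ y := fun h h' => h (Quotient.exact h')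
  obtain ⟨m, hm, hmP, hmab, hmcd⟩ := exists_isPairing_extending_pairs P hP hfixinf
    ((hfix a).2 ha) ((hfix b).2 hb) ((hfix c).2 hc) ((hfix d).2 hd) (hmk hab) (hmk hac) (hmk had)
    (hmk hbc) (hmk hbd) (hmk hcd)
  have hne := hm.conj_swap_apply_ne_iff hmab hmcd (hmk hbc) (hmk had) (hmk hac)
  have hm' := hm.conj (swap (Quotient.mk _ b) (Quotient.mk _ c))
  set m' := swap (Quotient.mk _ b) (Quotient.mk _ c) * m *
    (swap (Quotient.mk _ b) (Quotient.mk _ c))⁻¹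
  have hm'P : ∀ v, P v ≠ v → m' v = P v := by
    intro v hv
    rw [← hmP v hv]
    by_contra h
    rcases (hne v).1 h with rfl | rfl | rfl | rfl
    · exact hv ((hfix a).2 ha)
    · exact hv ((hfix b).2 hb)
    · exact hv ((hfix c).2 hc)
    · exact hv ((hfix d).2 hd)
  have hle : ∀ n : Perm (Quotient (SameCycle.setoid p)), IsPairing n →
      (∀ v, P v ≠ v → n v = P v) →
      SameCycle.setoid q ≤ (SameCycle.setoid n).comap (Quotient.mk (SameCycle.setoid p)) := by
    intro n hn hnP x y hxy
    change SameCycle.setoid n _ _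
    rcases hq.rel_iff.1 hxy with rfl | rfl
    · exact Setoid.refl' _ _
    · rw [hn.rel_iff, ← hPmk]
      by_cases h : P (Quotient.mk _ x) = Quotient.mk _ x
      · exact Or.inl h
      · exact Or.inr (hnP _ h).symm
  refine ⟨_, _, hp.isNRelation.comap_mk_iff.2 hm.isNRelation,
    hp.isNRelation.comap_mk_iff.2 hm'.isNRelation, Setoid.le_comap_mk _, Setoid.le_comap_mk _,
    hle m hm hmP, hle m' hm' hm'P, fun x => ?_⟩
  have h1 := hne (Quotient.mk _ x)
  rw [Quotient.eq, Quotient.eq, Quotient.eq, Quotient.eq] at h1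
  rw [← h1]
  constructor
  · rintro ⟨y, hy⟩ h
    apply hy
    rw [Setoid.comap_rel, Setoid.comap_rel, hm.rel_iff, hm'.rel_iff, h]
  · intro h
    obtain ⟨y, hy⟩ := Quotient.exists_rep (m (Quotient.mk _ x))
    refine ⟨y, fun h2 => ?_⟩
    rw [Setoid.comap_rel, Setoid.comap_rel, hm.rel_iff, hm'.rel_iff, hy] at h2
    rcases h2.1 (Or.inr rfl) with h3 | h3
    · exact hm.ne _ h3
    · exact h h3.symm

/-- Two commuting pairings are joined by a pairing which commutes with both and has infinitely
many blocks in common with each of them. -/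
theorem IsPairing.exists_halfway {X : Type*} [Infinite X] {p q : Perm X} (hp : IsPairing p)
    (hq : IsPairing q) (hpq : ∀ x, p (q x) = q (p x)) :
    ∃ h : Perm X, IsPairing h ∧ (∀ x, p (h x) = h (p x)) ∧ (∀ x, h (q x) = q (h x)) ∧
      {x | p x = h x}.Infinite ∧ {x | h x = q x}.Infinite ∧ ∀ x, p x = q x → p x = h x := by
  classical
  let O : X → Set X := fun x => {x, p x, q x, p (q x)}
  have hO : ∀ x, x ∈ O x := fun x => Or.inl rfl
  have hOp : ∀ x, O (p x) = O x := by
    intro x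
    ext y
    simp only [O, Set.mem_insert_iff, Set.mem_singleton_iff, ← hpq, hp.sq]
    tauto
  have hOq : ∀ x, O (q x) = O x := by
    intro x
    ext y
    simp only [O, Set.mem_insert_iff, Set.mem_singleton_iff, hpq, hq.sq]
    tauto
  have hrange : (Set.range O).Infinite := by
    intro hfin
    rw [← Set.image_univ] at hfin
    refine Set.infinite_univ (Set.Finite.of_finite_fibers O hfin ?_)
    rintro _ ⟨x, -, rfl⟩
    refine (Set.toFinite (O x)).subset ?_
    rintro y ⟨-, hy⟩
    have hy' : O y = O x := hy
    rw [← hy']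
    exact hO y
  -- The orbits of the group generated by `p` and `q` are finite, hence infinite in number. They are
  -- split into two infinite families, with `p` used on the first and `q` on the second.
  obtain ⟨R, S, hRS, hdisj, hcard⟩ := hrange.exists_union_disjoint_cardinal_eq_of_infinite
  have hinf : R.Infinite ∧ S.Infinite := by
    have hiff : R.Finite ↔ S.Finite := by
      rw [← Set.finite_coe_iff, ← Set.finite_coe_iff, ← Cardinal.lt_aleph0_iff_finite, hcard,
        Cardinal.lt_aleph0_iff_finite]
    constructor
    · intro h
      exact hrange (hRS ▸ h.union (hiff.1 h))
    · intro h
      exact hrange (hRS ▸ (hiff.2 h).union h)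
  have hpre : ∀ U : Set (Set X), U ⊆ Set.range O → U.Infinite → (O ⁻¹' U).Infinite := by
    intro U hU hUinf hfin
    apply hUinf
    rw [← Set.image_preimage_eq_of_subset hU]
    exact hfin.image O
  let h : X → X := fun x => if O x ∈ R then p x else q x
  have h1 : ∀ x, O x ∈ R → h x = p x := fun x hx => if_pos hx
  have h2 : ∀ x, O x ∉ R → h x = q x := fun x hx => if_neg hx
  have hh : Function.Involutive h := by
    intro x
    by_cases hx : O x ∈ R
    · rw [h1 x hx, h1 _ (by rwa [hOp]), hp.sq]
    · rw [h2 x hx, h2 _ (by rwa [hOq]), hq.sq]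
  refine ⟨hh.toPerm h, ⟨hh, fun x => ?_⟩, fun x => ?_, fun x => ?_, ?_, ?_, fun x hx => ?_⟩
  · change h x ≠ x
    by_cases hx : O x ∈ R
    · rw [h1 x hx]; exact hp.ne x
    · rw [h2 x hx]; exact hq.ne x
  · change p (h x) = h (p x)
    by_cases hx : O x ∈ R
    · rw [h1 x hx, h1 _ (by rwa [hOp])]
    · rw [h2 x hx, h2 _ (by rwa [hOp]), hpq]
  · change h (q x) = q (h x)
    by_cases hx : O x ∈ R
    · rw [h1 x hx, h1 _ (by rwa [hOq]), hpq]
    · rw [h2 x hx, h2 _ (by rwa [hOq])]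
  · refine (hpre R (hRS ▸ Set.subset_union_left) hinf.1).mono fun x hx => ?_
    exact (h1 x hx).symm
  · refine (hpre S (hRS ▸ Set.subset_union_right) hinf.2).mono fun x hx => ?_
    exact h2 x fun hx' => Set.disjoint_left.1 hdisj hx' hx
  · change p x = h x
    by_cases hx' : O x ∈ R
    · rw [h1 x hx']
    · rw [h2 x hx', hx]

/-! ### Images of blocks and their independence of the pairing. -/

/-- The 2-relation of a pairing as an element of `EqStar X`. -/
def IsPairing.toEqStar {X : Type*} {p : Perm X} (hp : IsPairing p) : EqStar X :=
  ⟨SameCycle.setoid p, 2, hp.isNRelation⟩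

section

variable {X : Type*} [Infinite X] {β : EqStar X ≃o EqStar X}

/-- The block of `β p` corresponding to the block of `x` for the pairing `p`. -/
noncomputable def IsSizePreserving.imageBlock (hβ : IsSizePreserving β) {p : Perm X}
    (hp : IsPairing p) (x : X) : Set X :=
  {z | (hβ.exists_quotient_equiv (π := hp.toEqStar) hp.isNRelation).choose (Quotient.mk _ x) =
    Quotient.mk _ z}

variable {p q : Perm X}

theorem IsSizePreserving.rel_iff_of_mem_imageBlock (hβ : IsSizePreserving β) (hp : IsPairing p)
    {θ : EqStar X} (hpθ : hp.toEqStar ≤ θ) (hθ : IsNRelation 4 θ.1) {x y z w : X}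
    (hz : z ∈ hβ.imageBlock hp x) (hw : w ∈ hβ.imageBlock hp y) : θ.1 x y ↔ (β θ).1 z w :=
  (hβ.exists_quotient_equiv (π := hp.toEqStar) hp.isNRelation).choose_spec θ hpθ hθ x y z w hz hw

theorem IsSizePreserving.imageBlock_nonempty (hβ : IsSizePreserving β) (hp : IsPairing p)
    (x : X) : ∃ z, z ∈ hβ.imageBlock hp x := by
  obtain ⟨z, hz⟩ := Quotient.exists_rep
    ((hβ.exists_quotient_equiv (π := hp.toEqStar) hp.isNRelation).choose (Quotient.mk _ x))
  exact ⟨z, hz.symm⟩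

theorem IsSizePreserving.exists_mem_imageBlock (hβ : IsSizePreserving β) (hp : IsPairing p)
    (z : X) : ∃ x, z ∈ hβ.imageBlock hp x := by
  obtain ⟨v, hv⟩ := (hβ.exists_quotient_equiv (π := hp.toEqStar)
    hp.isNRelation).choose.surjective (Quotient.mk _ z)
  obtain ⟨x, rfl⟩ := Quotient.exists_rep v
  exact ⟨x, hv⟩

theorem IsSizePreserving.mem_imageBlock_iff_rel (hβ : IsSizePreserving β) (hp : IsPairing p)
    {x z w : X} (hz : z ∈ hβ.imageBlock hp x) :
    w ∈ hβ.imageBlock hp x ↔ (β hp.toEqStar).1 z w := by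
  rw [← Quotient.eq]
  change _ = _ ↔ _
  rw [show _ = Quotient.mk _ z from hz]

theorem IsSizePreserving.mem_imageBlock_iff (hβ : IsSizePreserving β) (hp : IsPairing p)
    {x y z : X} (hz : z ∈ hβ.imageBlock hp x) :
    z ∈ hβ.imageBlock hp y ↔ SameCycle.setoid p x y := by
  change _ = _ ↔ hp.toEqStar.1 x y
  rw [← show _ = Quotient.mk _ z from hz, Equiv.apply_eq_iff_eq, eq_comm, Quotient.eq]

/-- The block bijection of `p` carries each 4-relation above `p` to its image under `β`, so it also
carries the set where two of them differ. That set is defined without reference to `p`, which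
permits comparison with another pairing below the same relations. -/
theorem IsSizePreserving.mem_differSet_iff (hβ : IsSizePreserving β) (hp : IsPairing p)
    {θ θ' : EqStar X} (hpθ : hp.toEqStar ≤ θ) (hpθ' : hp.toEqStar ≤ θ') (hθ : IsNRelation 4 θ.1)
    (hθ' : IsNRelation 4 θ'.1) {x z : X} (hz : z ∈ hβ.imageBlock hp x) :
    z ∈ (β θ).1.differSet (β θ').1 ↔ x ∈ θ.1.differSet θ'.1 := by
  constructor
  · rintro ⟨w, hw⟩
    obtain ⟨y, hy⟩ := hβ.exists_mem_imageBlock hp w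
    refine ⟨y, ?_⟩
    rwa [hβ.rel_iff_of_mem_imageBlock hp hpθ hθ hz hy,
      hβ.rel_iff_of_mem_imageBlock hp hpθ' hθ' hz hy]
  · rintro ⟨y, hy⟩
    obtain ⟨w, hw⟩ := hβ.imageBlock_nonempty hp y
    refine ⟨w, ?_⟩
    rwa [← hβ.rel_iff_of_mem_imageBlock hp hpθ hθ hz hw,
      ← hβ.rel_iff_of_mem_imageBlock hp hpθ' hθ' hz hw]

theorem IsPairing.rel_iff_rel_of_apply_eq {V : Type*} {p q : Perm V} (hp : IsPairing p)
    (hq : IsPairing q) {a : V} (ha : p a = q a) (x : V) :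
    SameCycle.setoid p x a ↔ SameCycle.setoid q x a := by
  rw [Setoid.comm', hp.rel_iff, Setoid.comm', hq.rel_iff, ha]

theorem IsPairing.exists_unrelated {V : Type*} {p : Perm V} (hp : IsPairing p) {C : Set V}
    (hC : C.Infinite) {S : Set V} (hS : S.Finite) :
    ∃ y ∈ C, ∀ x ∈ S, ¬SameCycle.setoid p x y := by
  obtain ⟨y, hyC, hy⟩ := (hC.sdiff (hS.union (hS.image p))).nonempty
  refine ⟨y, hyC, fun x hx h => hy ?_⟩
  rcases hp.rel_iff.1 h with rfl | rfl
  · exact Or.inl hx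
  · exact Or.inr ⟨x, hx, rfl⟩

/-- The images of a common block of two commuting pairings agree if the pairings have infinitely
many common blocks. -/
theorem IsSizePreserving.imageBlock_subset_of_infinite (hβ : IsSizePreserving β)
    (hp : IsPairing p) (hq : IsPairing q) (hpq : ∀ x, p (q x) = q (p x))
    (hinf : {x | p x = q x}.Infinite) {a : X} (ha : p a = q a) :
    hβ.imageBlock hp a ⊆ hβ.imageBlock hq a := by
  have four : ∀ b c d, p b = q b → p c = q c → p d = q d → ¬SameCycle.setoid p a b →
      ¬SameCycle.setoid p a c → ¬SameCycle.setoid p a d → ¬SameCycle.setoid p b c →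
      ¬SameCycle.setoid p b d → ¬SameCycle.setoid p c d → ∀ z x, z ∈ hβ.imageBlock hp a →
      z ∈ hβ.imageBlock hq x → SameCycle.setoid p x a ∨ SameCycle.setoid p x b ∨
        SameCycle.setoid p x c ∨ SameCycle.setoid p x d := by
    intro b c d hb hc hd hab hac had hbc hbd hcd z x hza hzx
    obtain ⟨θ, θ', hθ, hθ', hpθ, hpθ', hqθ, hqθ', hD⟩ := hp.exists_differSet_eq hq hpq hinf ha hb
      hc hd hab hac had hbc hbd hcd
    rw [← hD]
    rw [← hβ.mem_differSet_iff (θ := ⟨θ, 4, hθ⟩) (θ' := ⟨θ', 4, hθ'⟩) hq hqθ hqθ' hθ hθ' hzx,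
      hβ.mem_differSet_iff (θ := ⟨θ, 4, hθ⟩) (θ' := ⟨θ', 4, hθ'⟩) hp hpθ hpθ' hθ hθ' hza, hD]
    exact Or.inl (Setoid.refl' _ _)
  intro z hz
  obtain ⟨x, hx⟩ := hβ.exists_mem_imageBlock hq z
  -- Six further common blocks give two quadruples `a, b, c, d` and `a, e, f, g` that share only the
  -- block of `a`; the block of `x` belongs to both.
  obtain ⟨b, hb, hb'⟩ := hp.exists_unrelated hinf (Set.toFinite {a})
  obtain ⟨c, hc, hc'⟩ := hp.exists_unrelated hinf (Set.toFinite {a, b})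
  obtain ⟨d, hd, hd'⟩ := hp.exists_unrelated hinf (Set.toFinite {a, b, c})
  obtain ⟨e, he, he'⟩ := hp.exists_unrelated hinf (Set.toFinite {a, b, c, d})
  obtain ⟨f, hf, hf'⟩ := hp.exists_unrelated hinf (Set.toFinite {a, b, c, d, e})
  obtain ⟨g, hg, hg'⟩ := hp.exists_unrelated hinf (Set.toFinite {a, b, c, d, e, f})
  simp only [Set.mem_insert_iff, Set.mem_singleton_iff, forall_eq_or_imp, forall_eq] at *
  obtain ⟨hac, hbc⟩ := hc'
  obtain ⟨had, hbd, hcd⟩ := hd'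
  obtain ⟨hae, hbe, hce, hde⟩ := he'
  obtain ⟨haf, hbf, hcf, hdf, hef⟩ := hf'
  obtain ⟨hag, hbg, hcg, hdg, heg, hfg⟩ := hg'
  have h1 := four b c d hb hc hd hb' hac had hbc hbd hcd z x hz hx
  have h2 := four e f g he hf hg hae haf hag hef heg hfg z x hz hx
  rw [hβ.mem_imageBlock_iff hq hx, ← hp.rel_iff_rel_of_apply_eq hq ha]
  have ht : ∀ {u v}, SameCycle.setoid p x u → SameCycle.setoid p x v → SameCycle.setoid p u v :=
    fun h h' => Setoid.trans' _ (Setoid.symm' _ h) h'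
  rcases h1 with h1 | h1 | h1 | h1
  · exact h1
  all_goals rcases h2 with h2 | h2 | h2 | h2
  all_goals first | exact h2 | exact absurd (ht h1 h2) ‹_›

theorem IsSizePreserving.imageBlock_subset_of_commute (hβ : IsSizePreserving β)
    (hp : IsPairing p) (hq : IsPairing q) (hpq : ∀ x, p (q x) = q (p x)) {a : X}
    (ha : p a = q a) : hβ.imageBlock hp a ⊆ hβ.imageBlock hq a := by
  obtain ⟨h, hh, hph, hhq, hinf, hinf', hagree⟩ := hp.exists_halfway hq hpq
  have hpa := hagree a ha
  exact (hβ.imageBlock_subset_of_infinite hp hh hph hinf hpa).trans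
    (hβ.imageBlock_subset_of_infinite hh hq hhq hinf' (hpa.symm.trans ha))

/-- The image of a block does not depend on the pairing it belongs to. -/
theorem IsSizePreserving.imageBlock_subset (hβ : IsSizePreserving β) (hp : IsPairing p)
    (hq : IsPairing q) {a : X} (ha : p a = q a) :
    hβ.imageBlock hp a ⊆ hβ.imageBlock hq a := by
  obtain ⟨c, hc, hpc, hqc, hca⟩ := hp.exists_commute hq ha
  exact (hβ.imageBlock_subset_of_commute hp hc hpc hca.symm).trans
    (hβ.imageBlock_subset_of_commute hc hq (fun x => (hqc x).symm) (hca.trans ha))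

theorem exists_isPairing_apply_eq {V : Type*} [Infinite V] {a b : V} (hab : a ≠ b) :
    ∃ p : Perm V, IsPairing p ∧ p a = b := by
  obtain ⟨c, hc⟩ := (Set.toFinite {a, b}).exists_notMem
  obtain ⟨d, hd⟩ := (Set.toFinite {a, b, c}).exists_notMem
  simp only [Set.mem_insert_iff, Set.mem_singleton_iff, not_or] at hc hd
  obtain ⟨p, hp, h, -⟩ := exists_isPairing_of_ne hab (Ne.symm hc.1) (Ne.symm hd.1)
    (Ne.symm hc.2) (Ne.symm hd.2.1) (Ne.symm hd.2.2)
  exact ⟨p, hp, h⟩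

/-- A size preserving automorphism translates pairs of points. -/
theorem IsSizePreserving.exists_pair (hβ : IsSizePreserving β) {a b : X} (hab : a ≠ b) :
    ∃ c d, c ≠ d ∧ ∀ π : EqStar X, IsNRelation 2 π.1 → π.1 a b → (β π).1 c d := by
  obtain ⟨p, hp, hpab⟩ := exists_isPairing_apply_eq hab
  obtain ⟨c, hc⟩ := hβ.imageBlock_nonempty hp a
  obtain ⟨p', hp', hpe⟩ := (hβ 2 hp.toEqStar hp.isNRelation).exists_isPairing
  have hd : p' c ∈ hβ.imageBlock hp a := by
    rw [hβ.mem_imageBlock_iff_rel hp hc, ← hpe]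
    exact hp'.rel_apply c
  refine ⟨c, p' c, (hp'.ne c).symm, fun π hπ hπab => ?_⟩
  obtain ⟨q, hq, hqe⟩ := hπ.exists_isPairing
  rw [← hqe] at hπab
  have hqab : p a = q a := hpab.trans (hq.apply_eq_of_rel hab hπab).symm
  have hsub := hβ.imageBlock_subset hp hq hqab
  have hπ' : π = hq.toEqStar := Subtype.ext hqe.symm
  rw [hπ']
  exact (hβ.mem_imageBlock_iff_rel hq (hsub hc)).1 (hsub hd)

end

theorem mainTheorem3 {X : Type*} [Infinite X] (β : EqStar X ≃o EqStar X)
    (hβ : IsSizePreserving β) :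
    ∃ σ : Equiv.Perm X, ∀ π : EqStar X, IsNRelation 2 π.1 → (β π).1 = permImage σ π.1 := by
  -- The family is now indexed by all 2-relations on `X`, paired with their images; the backward
  -- translation of edges comes from `β.symm`.
  obtain ⟨σ, hσ⟩ := exists_equiv_of_edge_maps
    (fun t : {π : EqStar X // IsNRelation 2 π.1} => t.1.1) (fun t => (β t.1).1) (fun t => t.2)
    (fun t => hβ 2 _ t.2) (fun m hm => ⟨⟨⟨m, 2, hm⟩, hm⟩, rfl⟩)
    (fun m hm => ⟨⟨β.symm ⟨m, 2, hm⟩, hβ.symm 2 ⟨m, 2, hm⟩ hm⟩, by simp⟩)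
    (fun a b hab => by
      obtain ⟨c, d, hcd, h⟩ := hβ.exists_pair hab
      exact ⟨c, d, hcd, fun t => h t.1 t.2⟩)
    (fun a b hab => by
      obtain ⟨c, d, hcd, h⟩ := hβ.symm.exists_pair hab
      refine ⟨c, d, hcd, fun t ht => ?_⟩
      have h1 := h (β t.1) (hβ 2 _ t.2) ht
      rwa [OrderIso.symm_apply_apply] at h1)
  refine ⟨σ, fun π hπ => ?_⟩
  ext x y
  have h := hσ ⟨π, hπ⟩ (σ.symm x) (σ.symm y)
  rw [σ.apply_symm_apply, σ.apply_symm_apply] at h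
  rw [← h]
  constructor
  · intro h1
    exact ⟨σ.symm x, σ.symm y, h1, σ.apply_symm_apply x, σ.apply_symm_apply y⟩
  · rintro ⟨u, v, huv, rfl, rfl⟩
    rwa [σ.symm_apply_apply, σ.symm_apply_apply]
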